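/- Let $\mathbb{G}$ be a Polish space with its Borel $\sigma$-algebra, $q_M$ a probability distribution on $\{0,1,2,\dots\}$ and $\nu$ a probability measure on $\mathbb{G}$. Write $\mathrm{IFPP}(q_M,\nu)$ for the law of the random measure $\sum_{m=1}^{M}\delta_{\xi_m}$, where $M\sim q_M$ and, given $M$, the points $\xi_1,\dots,\xi_M$ are i.i.d. with law $\nu$. Let $\Phi\sim\mathrm{IFPP}(q_M,\nu)$ be a point process on $\mathbb{G}$, let $k\ge 0$ be an integer, and put $\mathbb{E}[M^{(k)}]:=\mathbb{E}[M(M-1)\cdots(M-k+1)]$. Assume $0<\mathbb{E}[M^{(k)}]<\infty$. Notation. For a point measure $\varphi=\sum_{i\in I}\delta_{\xi_i}$ ($I$ countable, repetitions allowed) let $\varphi^k$ be its $k$-fold product and $\varphi^{(k)}$ the sum of $\delta_{(\xi_{i_1},\dots,\xi_{i_k})}$ over all $k$-tuples of pairwise distinct indices. Let $M_{\Phi^k}(B)=\mathbb{E}[\Phi^k(B)]$ and $M_{\Phi^{(k)}}(B)=\mathbb{E}[\Phi^{(k)}(B)]$. A $k$-th *reduced Palm kernel* of $\Phi$ is a probability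 kernel $\mathbf{x}\mapsto \mathbf{P}^{\mathbf{x}}_{\Phi^!}$ from $\mathbb{G}^k$ to measures on $\mathbb{G}$ with $$\mathbb{E}\Big[\int_B \mathbf 1_L\Big(\Phi-\sum_{j=1}^k\delta_{x_j}\Big)\,\Phi^{(k)}(d\mathbf{x})\Big]=\int_B \mathbf{P}^{\mathbf{x}}_{\Phi^!}(L)\,M_{\Phi^{(k)}}(d\mathbf{x})$$ for all measurable $B,L$; a $k$-th *Palm kernel* is a probability kernel $\mathbf{x}\mapsto\mathbf{P}^{\mathbf{x}}_{\Phi}$ with $\mathbb{E}\big[\int_B \mathbf 1_L(\Phi)\,\Phi^{k}(d\mathbf{x})\big]=\int_B \mathbf{P}^{\mathbf{x}}_{\Phi}(L)\,M_{\Phi^{k}}(d\mathbf{x})$ for all measurable $B,L$. The reduced Palm version $\Phi^!_{\mathbf{x}}$ of $\Phi$ at $\mathbf{x}$ is a point process with law $\mathbf{P}^{\mathbf{x}}_{\Phi^!}$, and the Palm version $\Phi_{\mathbf{x}}$ one with law $\mathbf{P}^{\mathbf{x}}_{\Phi}$. Theorem. One has $$\mathbb{E}[M^{(k)}]=\sum_{m=0}^\infty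 q_M(m+k)\frac{(m+k)!}{m!},$$ the formula $$q^!_M(m)=\frac{1}{\mathbb{E}[M^{(k)}]}\,q_M(m+k)\,\frac{(m+k)!}{m!},\qquad m=0,1,2,\dots,$$ defines a probability distribution $q^!_M$ on $\{0,1,2,\dots\}$, and the $k$-th order reduced Palm version of $\Phi$ at $\mathbf{x}=(x_1,\dots,x_k)$ is an $\mathrm{IFPP}(q^!_M,\nu)$, with the same law $\nu$ of the i.i.d. atoms. Precisely: 1. the kernel that is constantly equal to the law $\mathrm{IFPP}(q^!_M,\nu)$ is a $k$-th reduced Palm kernel of $\Phi$; 2. every $k$-th reduced Palm kernel of $\Phi$ satisfies $\mathbf{P}^{\mathbf{x}}_{\Phi^!}=\mathrm{IFPP}(q^!_M,\nu)$ for $M_{\Phi^{(k)}}$-almost every $\mathbf{x}$; 3. for every $k$-th Palm kernel of $\Phi$ and for $M_{\Phi^k}$-almost every $\mathbf{x}$ with pairwise distinct coordinates, $\Phi_{\mathbf{x}}-\sum_{j=1}^k\delta_{x_j}\sim\mathrm{IFPP}(q^!_M,\nu)$. -/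

import Mathlib

open MeasureTheory ProbabilityTheory
open scoped ENNReal

noncomputable section

namespace IFPP

theorem sum_dirac_singleton {G : Type*} [MeasurableSpace G] [MeasurableSingletonClass G]
    {ι : Type*} (ξ : ι → G) (a : G) :
    Measure.sum (fun i => Measure.dirac (ξ i)) {a} = (ENat.card {i // ξ i = a} : ℝ≥0∞) := by
  classical
  rw [Measure.sum_apply _ (measurableSet_singleton a)]
  have h1 : ∀ i, Measure.dirac (ξ i) {a} =
      Set.indicator {i | ξ i = a} (fun _ => (1 : ℝ≥0∞)) i := by
    intro i
    rw [Measure.dirac_apply]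
    simp [Set.indicator]
  simp_rw [h1]
  rw [← tsum_subtype, ENNReal.tsum_set_one]
  rfl

/-- Two countable families of points with the same counting measure are reindexings of each
other. -/
theorem exists_equiv_of_sum_dirac_eq {G : Type*} [MeasurableSpace G] [MeasurableSingletonClass G]
    {ι κ : Type*} [Countable ι] [Countable κ] (ξ : ι → G) (η : κ → G)
    (h : Measure.sum (fun i => Measure.dirac (ξ i)) = Measure.sum (fun j => Measure.dirac (η j))) :
    ∃ e : ι ≃ κ, ∀ i, η (e i) = ξ i := by
  have hcard : ∀ a, ENat.card {i // ξ i = a} = ENat.card {j // η j = a} := by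
    intro a
    have := sum_dirac_singleton ξ a
    rw [h, sum_dirac_singleton η a] at this
    exact_mod_cast this.symm
  have heq : ∀ a, Nonempty ({i // ξ i = a} ≃ {j // η j = a}) := by
    intro a
    have ha := hcard a
    rcases finite_or_infinite {i // ξ i = a} with hf | hf
    · have hf' : Finite {j // η j = a} := by
        rw [← ENat.card_lt_top, ← ha, ENat.card_lt_top]; exact hf
      refine Finite.card_eq.1 ?_
      rw [ENat.card_eq_coe_natCard, ENat.card_eq_coe_natCard] at ha
      exact_mod_cast ha
    · have hf' : Infinite {j // η j = a} := by
        rw [← ENat.card_eq_top, ← ha, ENat.card_eq_top]; exact hf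
      exact nonempty_equiv_of_countable
  let e := fun a => (heq a).some
  refine ⟨(Equiv.sigmaFiberEquiv ξ).symm.trans
    ((Equiv.sigmaCongrRight e).trans (Equiv.sigmaFiberEquiv η)), fun i => ?_⟩
  exact (e (ξ i) ⟨i, rfl⟩).2

open Classical in
/-- The `k`-th factorial power `φ^{(k)}` of a point measure `φ = ∑ᵢ δ_{ξᵢ}` (a countable sum of
Dirac masses, repetitions allowed): the sum of the Dirac masses at `(ξ_{i₁}, …, ξ_{i_k})` over all
`k`-tuples of pairwise distinct indices. It does not depend on the enumeration of the atoms
(`factorialPower_sum_dirac`). Measures that are not point measures get the value `0`. -/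
def factorialPower {G : Type*} [MeasurableSpace G] (k : ℕ) (φ : Measure G) :
    Measure (Fin k → G) :=
  if h : ∃ (S : Set ℕ) (ξ : S → G), φ = Measure.sum (fun i => Measure.dirac (ξ i)) then
    Measure.sum (fun e : Fin k ↪ h.choose =>
      Measure.dirac (fun j => h.choose_spec.choose (e j)))
  else 0

theorem factorialPower_sum_dirac {G : Type*} [MeasurableSpace G] [MeasurableSingletonClass G]
    {ι : Type*} [Countable ι] (k : ℕ) (ξ : ι → G) :
    factorialPower k (Measure.sum (fun i => Measure.dirac (ξ i))) =
      Measure.sum (fun e : Fin k ↪ ι => Measure.dirac (fun j => ξ (e j))) := by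
  have h : ∃ (S : Set ℕ) (η : S → G),
      Measure.sum (fun i => Measure.dirac (ξ i)) = Measure.sum (fun i => Measure.dirac (η i)) := by
    obtain ⟨f, hf⟩ := exists_injective_nat ι
    let u : ι ≃ Set.range f := Equiv.ofInjective f hf
    refine ⟨Set.range f, fun s => ξ (u.symm s), ?_⟩
    ext B hB
    rw [Measure.sum_apply _ hB, Measure.sum_apply _ hB, ← u.tsum_eq]
    simp
  rw [factorialPower, dif_pos h]
  obtain ⟨e, he⟩ := exists_equiv_of_sum_dirac_eq ξ h.choose_spec.choose h.choose_spec.choose_spec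
  ext B hB
  rw [Measure.sum_apply _ hB, Measure.sum_apply _ hB,
    ← (Equiv.embeddingCongr (Equiv.refl (Fin k)) e).tsum_eq]
  simp [Equiv.embeddingCongr, he]

/-- The `k`-th (measure-theoretic) power `φ^k` of a measure `φ`. -/
def power {G : Type*} [MeasurableSpace G] (k : ℕ) (φ : Measure G) : Measure (Fin k → G) :=
  Measure.pi (fun _ => φ)

/-- The measure `∑ⱼ δ_{xⱼ}` of a finite tuple of points. -/
def sumDirac {G : Type*} [MeasurableSpace G] {k : ℕ} (x : Fin k → G) : Measure G :=
  ∑ j, Measure.dirac (x j)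

/-- The law `IFPP(q, ν)` on the space of measures (with the σ-algebra generated by the evaluations
`φ ↦ φ B`): the law of `∑_{i ≤ M} δ_{ξᵢ}` where `M ∼ q` and, given `M = m`, the points
`ξ₁, …, ξₘ` are i.i.d. with law `ν`. -/
def ifppLaw {G : Type*} [MeasurableSpace G] (q : PMF ℕ) (ν : Measure G) : Measure (Measure G) :=
  Measure.sum (fun m : ℕ => q m • (Measure.pi (fun _ : Fin m => ν)).map sumDirac)

/-- The factorial moment `E[M (M - 1) ⋯ (M - k + 1)]` for `M ∼ q`. -/
def factorialMoment (q : PMF ℕ) (k : ℕ) : ℝ≥0∞ :=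
  ∫⁻ m, (m.descFactorial k : ℝ≥0∞) ∂q.toMeasure

variable {Ω G : Type*} [MeasurableSpace Ω] [MeasurableSpace G]

/-- The `k`-th moment measure `B ↦ E[Φ^k(B)]`. -/
def momentMeasure (P : Measure Ω) (Φ : Ω → Measure G) (k : ℕ) : Measure (Fin k → G) :=
  P.bind (fun ω => power k (Φ ω))

/-- The `k`-th factorial moment measure `B ↦ E[Φ^{(k)}(B)]`. -/
def factorialMomentMeasure (P : Measure Ω) (Φ : Ω → Measure G) (k : ℕ) : Measure (Fin k → G) :=
  P.bind (fun ω => factorialPower k (Φ ω))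

/-- The `k`-th Campbell measure `(B, L) ↦ E[∫_B 1_L(Φ) Φ^k(dx)]`. -/
def campbell (P : Measure Ω) (Φ : Ω → Measure G) (k : ℕ) (B : Set (Fin k → G))
    (L : Set (Measure G)) : ℝ≥0∞ :=
  ∫⁻ ω, power k (Φ ω) (B ∩ {_x | Φ ω ∈ L}) ∂P

/-- The reduced `k`-th Campbell measure
`(B, L) ↦ E[∫_B 1_L(Φ - ∑ⱼ δ_{xⱼ}) Φ^{(k)}(dx)]`. -/
def reducedCampbell (P : Measure Ω) (Φ : Ω → Measure G) (k : ℕ) (B : Set (Fin k → G))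
    (L : Set (Measure G)) : ℝ≥0∞ :=
  ∫⁻ ω, factorialPower k (Φ ω) (B ∩ {x | Φ ω - sumDirac x ∈ L}) ∂P

/-- `κ` is a `k`-th Palm kernel of `Φ`: a probability kernel disintegrating the `k`-th Campbell
measure with respect to the `k`-th moment measure. Here `κ x` is the law of the Palm version
of `Φ` at `x`. -/
def IsPalmKernel (P : Measure Ω) (Φ : Ω → Measure G) (k : ℕ)
    (κ : Kernel (Fin k → G) (Measure G)) : Prop :=
  IsMarkovKernel κ ∧ ∀ (B : Set (Fin k → G)) (L : Set (Measure G)),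
    MeasurableSet B → MeasurableSet L →
      campbell P Φ k B L = ∫⁻ x in B, κ x L ∂(momentMeasure P Φ k)

/-- `κ` is a `k`-th reduced Palm kernel of `Φ`: a probability kernel disintegrating the reduced
`k`-th Campbell measure with respect to the `k`-th factorial moment measure. Here `κ x` is the
law of the reduced Palm version of `Φ` at `x`. -/
def IsReducedPalmKernel (P : Measure Ω) (Φ : Ω → Measure G) (k : ℕ)
    (κ : Kernel (Fin k → G) (Measure G)) : Prop :=
  IsMarkovKernel κ ∧ ∀ (B : Set (Fin k → G)) (L : Set (Measure G)),
    MeasurableSet B → MeasurableSet L →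
      reducedCampbell P Φ k B L = ∫⁻ x in B, κ x L ∂(factorialMomentMeasure P Φ k)

end IFPP

end

/-! Condition on `M = n + k`. For each injection of `k` labels into the `n + k` points, the chosen
and the remaining points are independent i.i.d. samples of `ν`, and subtracting the chosen Dirac
masses leaves the sum over the remaining ones. There are `(n + k)! / n!` injections, so the reduced
Campbell measure is the product of `E[M^(k)] • ν^k` and `IFPP(q', ν)`, where `q'` is the normalised
weight `q (n + k) * (n + k)! / n!`. This is `lintegral_factorialPower_ifppLaw`. Almost sure
uniqueness of disintegrations, in `kernel_ae_eq_of_forall_setLIntegral_eq`, then determines every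
reduced Palm kernel.

On tuples with distinct coordinates `φ^k` and `φ^(k)` agree for finite point measures, so there a
Palm kernel must be the law of `∑ δ_{x_j} + Ψ` with `Ψ ∼ IFPP(q', ν)`. Subtracting the atoms gives
the last claim.

The technical burden is measurability: `factorialPower` is defined by choice, and subtraction of
measures is not evidently measurable. By `aemeasurable_of_sumDirac` it is enough to check
measurability in the coordinates of the points. -/

namespace IFPP

/-! ### Finite point measures as a measurable set, and descent of measurability along `sumDirac`. -/

section PointMeasures

variable {G : Type*}

theorem exists_countable_isPiSystem [m : MeasurableSpace G]
    [MeasurableSpace.CountablyGenerated G] :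
    ∃ C : Set (Set G), C.Countable ∧ Set.univ ∈ C ∧ IsPiSystem C ∧
      m = MeasurableSpace.generateFrom C := by
  refine ⟨generateSetAlgebra (MeasurableSpace.countableGeneratingSet G),
    countable_generateSetAlgebra MeasurableSpace.countable_countableGeneratingSet,
    isSetAlgebra_generateSetAlgebra.univ_mem,
    fun s hs t ht _ => isSetAlgebra_generateSetAlgebra.inter_mem hs ht, ?_⟩
  rw [generateFrom_generateSetAlgebra_eq, MeasurableSpace.generateFrom_countableGeneratingSet]

/-- The set of finite measures. -/
def finiteMeasures (G : Type*) [MeasurableSpace G] : Set (Measure G) := {φ | φ Set.univ < ∞}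

theorem measurableSet_finiteMeasures [MeasurableSpace G] : MeasurableSet (finiteMeasures G) :=
  Measure.measurable_coe MeasurableSet.univ measurableSet_Iio

theorem mem_finiteMeasures [MeasurableSpace G] (φ : Measure G) [IsFiniteMeasure φ] :
    φ ∈ finiteMeasures G :=
  measure_lt_top φ _

/-- On finite measures the evaluations at countably many sets generate all evaluations. -/
instance countablyGenerated_finiteMeasures [MeasurableSpace G]
    [MeasurableSpace.CountablyGenerated G] :
    MeasurableSpace.CountablyGenerated (finiteMeasures G) := by
  obtain ⟨C, hC, huniv, hpi, hgen⟩ := exists_countable_isPiSystem (G := G)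
  have : Countable C := hC
  let T : (finiteMeasures G) → C → ℝ≥0∞ := fun φ A => φ.1 A
  have hT : (Subtype.instMeasurableSpace : MeasurableSpace (finiteMeasures G)) =
      MeasurableSpace.comap T inferInstance := by
    apply le_antisymm
    · have hmeas : ∀ A ∈ C, Measurable[MeasurableSpace.comap T inferInstance]
          (fun φ : (finiteMeasures G) => φ.1 A) := fun A hA =>
        (measurable_pi_apply (⟨A, hA⟩ : C)).comp (comap_measurable T)
      have : ∀ φ : (finiteMeasures G), IsFiniteMeasure φ.1 := fun φ => ⟨φ.2⟩
      -- Finiteness matters here: the π-λ argument passes to complements by subtracting from the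
      -- total mass.
      have hval := @Measurable.measure_of_isPiSystem _ _ (MeasurableSpace.comap T inferInstance) _
        (fun φ : (finiteMeasures G) => φ.1) _ C hgen hpi hmeas
        (hmeas _ huniv)
      exact hval.comap_le
    · refine Measurable.comap_le (measurable_pi_iff.2 fun A => ?_)
      have hA : MeasurableSet (A : Set G) := by
        rw [hgen]; exact MeasurableSpace.measurableSet_generateFrom A.2
      exact (Measure.measurable_coe hA).comp measurable_subtype_coe
  rw [hT]
  exact MeasurableSpace.CountablyGenerated.comap T

instance separatesPoints_measure [MeasurableSpace G] :
    MeasurableSpace.SeparatesPoints (Measure G) where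
  separates φ ψ h := by
    refine Measure.ext fun A hA => ?_
    exact (h {χ | χ A = φ A} (Measure.measurable_coe hA (measurableSet_singleton _)) rfl).symm

/-- A measure all of whose values are natural numbers. -/
def IsNatValued [MeasurableSpace G] (φ : Measure G) : Prop :=
  ∀ A, MeasurableSet A → ∃ n : ℕ, φ A = n

theorem IsNatValued.isFiniteMeasure [MeasurableSpace G] {φ : Measure G} (h : IsNatValued φ) :
    IsFiniteMeasure φ := by
  obtain ⟨n, hn⟩ := h _ MeasurableSet.univ
  exact ⟨by rw [hn]; exact ENNReal.natCast_lt_top n⟩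

/-- A convergent series has only finitely many terms that are at least `1`, and a natural number
below `1` is `0`. -/
theorem exists_natCast_eq_tsum {f : ℕ → ℝ≥0∞} (h : ∀ i, ∃ n : ℕ, f i = n)
    (hf : ∑' i, f i ≠ ∞) : ∃ n : ℕ, ∑' i, f i = n := by
  choose n hn using h
  have h0 := (ENNReal.tendsto_cofinite_zero_of_tsum_ne_top hf).eventually_lt_const one_pos
  have hfin : {i | ¬ f i < 1}.Finite := h0
  refine ⟨∑ i ∈ hfin.toFinset, n i, ?_⟩
  rw [tsum_eq_sum (s := hfin.toFinset)]
  · push_cast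
    exact Finset.sum_congr rfl fun i _ => hn i
  · intro i hi
    have : f i < 1 := by simpa using hi
    rw [hn i] at this ⊢
    have : n i < 1 := by exact_mod_cast this
    simp [Nat.lt_one_iff.1 this]

theorem exists_natCast_eq_sub {a b : ℝ≥0∞} (ha : ∃ n : ℕ, a = n) (hb : ∃ n : ℕ, b = n) :
    ∃ n : ℕ, a - b = n := by
  obtain ⟨n, rfl⟩ := ha
  obtain ⟨m, rfl⟩ := hb
  exact ⟨n - m, by push_cast; rfl⟩

theorem isNatValued_of_isPiSystem [m : MeasurableSpace G] {C : Set (Set G)}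
    (hgen : m = MeasurableSpace.generateFrom C) (hpi : IsPiSystem C) (huniv : Set.univ ∈ C)
    {φ : Measure G} (h : ∀ A ∈ C, ∃ n : ℕ, φ A = n) : IsNatValued φ := by
  have hfin : IsFiniteMeasure φ := by
    obtain ⟨n, hn⟩ := h _ huniv
    exact ⟨by rw [hn]; exact ENNReal.natCast_lt_top n⟩
  intro A hA
  induction A, hA using MeasurableSpace.induction_on_inter hgen hpi with
  | empty => exact ⟨0, by simp⟩
  | basic t ht => exact h t ht
  | compl t ht ih =>
    rw [measure_compl ht (measure_ne_top φ t)]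
    exact exists_natCast_eq_sub (h _ huniv) ih
  | iUnion f hd hm ih =>
    have hsum := measure_iUnion hd hm (μ := φ)
    rw [hsum]
    exact exists_natCast_eq_tsum ih (hsum ▸ measure_ne_top φ _)

theorem IsNatValued.one_le [MeasurableSpace G] {φ : Measure G} (h : IsNatValued φ) {A : Set G}
    (hA : MeasurableSet A) (h0 : φ A ≠ 0) : 1 ≤ φ A := by
  obtain ⟨n, hn⟩ := h A hA
  rw [hn] at h0 ⊢
  have : n ≠ 0 := by exact_mod_cast h0
  exact_mod_cast Nat.one_le_iff_ne_zero.2 this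

/-- If all singletons were null, outer regularity would give each point an open neighbourhood of
mass below `1`, hence of mass `0`. A locally null measure on a second countable space vanishes. -/
theorem IsNatValued.exists_singleton_ne_zero [TopologicalSpace G] [PolishSpace G]
    [MeasurableSpace G] [BorelSpace G] {φ : Measure G} (h : IsNatValued φ) (h0 : φ ≠ 0) :
    ∃ a, φ {a} ≠ 0 := by
  by_contra! hc
  have := h.isFiniteMeasure
  let := TopologicalSpace.upgradeIsCompletelyMetrizable G
  refine h0 (Measure.measure_univ_eq_zero.1 (measure_null_of_locally_null _ fun x _ => ?_))
  obtain ⟨U, hU, hUo, hU1⟩ := Set.exists_isOpen_lt_of_lt {x} (μ := φ) 1 (by rw [hc]; exact one_pos)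
  refine ⟨U, mem_nhdsWithin_of_mem_nhds (hUo.mem_nhds (hU rfl)), ?_⟩
  by_contra hne
  exact absurd (h.one_le hUo.measurableSet hne) (not_le.2 hU1)

theorem dirac_le_of_one_le [MeasurableSpace G] [MeasurableSingletonClass G] {φ : Measure G} {a : G}
    (h : 1 ≤ φ {a}) : Measure.dirac a ≤ φ := by
  classical
  refine Measure.le_iff.2 fun A _ => ?_
  rw [Measure.dirac_apply]
  by_cases ha : a ∈ A
  · rw [Set.indicator_of_mem ha]
    exact h.trans (measure_mono (Set.singleton_subset_iff.2 ha))
  · simp [ha]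

theorem measurable_sumDirac [MeasurableSpace G] (m : ℕ) :
    Measurable (sumDirac : (Fin m → G) → Measure G) := by
  refine Measure.measurable_of_measurable_coe _ fun A hA => ?_
  simp only [sumDirac, Measure.coe_finsetSum, Finset.sum_apply]
  exact Finset.measurable_sum _ fun j _ =>
    (Measure.measurable_coe hA).comp (Measure.measurable_dirac.comp (measurable_pi_apply j))

instance isFiniteMeasure_sumDirac [MeasurableSpace G] {m : ℕ} (x : Fin m → G) :
    IsFiniteMeasure (sumDirac x) := by
  unfold sumDirac; infer_instance

theorem isNatValued_sumDirac [MeasurableSpace G] {m : ℕ} (x : Fin m → G) :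
    IsNatValued (sumDirac x) := by
  classical
  intro A hA
  refine ⟨∑ j, if x j ∈ A then 1 else 0, ?_⟩
  simp only [sumDirac, Measure.coe_finsetSum, Finset.sum_apply, Measure.dirac_apply' _ hA,
    Set.indicator_apply, Pi.one_apply]
  push_cast
  rfl

theorem sumDirac_univ [MeasurableSpace G] {m : ℕ} (x : Fin m → G) :
    sumDirac x Set.univ = m := by
  simp [sumDirac]

/-- A measure with natural values and total mass `m` on a Polish space is a sum of `m` Dirac
masses. -/
theorem IsNatValued.exists_eq_sumDirac [TopologicalSpace G] [PolishSpace G]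
    [MeasurableSpace G] [BorelSpace G] (m : ℕ) {φ : Measure G} (h : IsNatValued φ)
    (hm : φ Set.univ = m) : ∃ x : Fin m → G, sumDirac x = φ := by
  induction m generalizing φ with
  | zero =>
    refine ⟨Fin.elim0, ?_⟩
    have h0 : φ = 0 := Measure.measure_univ_eq_zero.1 (by simpa using hm)
    rw [h0]
    simp [sumDirac]
  | succ m ih =>
    have h0 : φ ≠ 0 := by
      rintro rfl
      have : ((0 : ℕ) : ℝ≥0∞) = (m + 1 : ℕ) := by simpa using hm
      exact absurd (Nat.cast_injective this) (by simp)
    -- Peel off one atom: the remainder is again natural valued, with total mass `m`.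
    obtain ⟨a, ha⟩ := h.exists_singleton_ne_zero h0
    have hle := dirac_le_of_one_le (h.one_le (measurableSet_singleton a) ha)
    have hnat : IsNatValued (φ - Measure.dirac a) := fun A hA => by
      rw [Measure.sub_apply hA hle]
      refine exists_natCast_eq_sub (h A hA) ?_
      simpa [sumDirac] using isNatValued_sumDirac (fun _ : Fin 1 => a) A hA
    obtain ⟨x, hx⟩ := ih hnat (by
      rw [Measure.sub_apply MeasurableSet.univ hle, hm]
      simp)
    refine ⟨Fin.snoc x a, ?_⟩
    rw [← Measure.sub_add_cancel_of_le hle, ← hx]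
    simp [sumDirac, Fin.sum_univ_castSucc]

/-- The range is cut out by countably many evaluations: total mass `m` and natural values on a
countable generating π-system. -/
theorem measurableSet_range_sumDirac [TopologicalSpace G] [PolishSpace G]
    [MeasurableSpace G] [BorelSpace G] (m : ℕ) :
    MeasurableSet (Set.range (sumDirac : (Fin m → G) → Measure G)) := by
  obtain ⟨C, hC, huniv, hpi, hgen⟩ := exists_countable_isPiSystem (G := G)
  have heq : Set.range (sumDirac : (Fin m → G) → Measure G) =
      {φ | φ Set.univ = (m : ℝ≥0∞)} ∩ ⋂ A ∈ C, {φ | φ A ∈ Set.range ((↑) : ℕ → ℝ≥0∞)} := by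
    ext φ
    simp only [Set.mem_inter_iff, Set.mem_ofPred_eq, Set.mem_iInter]
    have hCm : ∀ A ∈ C, MeasurableSet A := fun A hA => by
      rw [hgen]; exact MeasurableSpace.measurableSet_generateFrom hA
    constructor
    · rintro ⟨x, rfl⟩
      refine ⟨sumDirac_univ x, fun A hA => ?_⟩
      obtain ⟨n, hn⟩ := isNatValued_sumDirac x A (hCm A hA)
      exact ⟨n, hn.symm⟩
    · rintro ⟨h1, h2⟩
      refine (isNatValued_of_isPiSystem hgen hpi huniv fun A hA => ?_).exists_eq_sumDirac m h1
      obtain ⟨n, hn⟩ := h2 A hA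
      exact ⟨n, hn.symm⟩
  rw [heq]
  refine (Measure.measurable_coe MeasurableSet.univ (measurableSet_singleton _)).inter
    (MeasurableSet.biInter hC fun A hA => Measure.measurable_coe ?_
      (Set.countable_range _).measurableSet)
  rw [hgen]
  exact MeasurableSpace.measurableSet_generateFrom hA

/-- A Lusin–Souslin argument: along a measurable map from a standard Borel space onto a countably
separated range, measurability of a composition descends to the range. Countable separation is
inherited from `finiteMeasures G`. -/
theorem measurable_domRestrict_range_sumDirac [TopologicalSpace G] [PolishSpace G]
    [MeasurableSpace G] [BorelSpace G] {β : Type*} [MeasurableSpace β] {m : ℕ}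
    {h : Measure G → β} (hh : Measurable fun x : Fin m → G => h (sumDirac x)) :
    Measurable fun φ : Set.range (sumDirac : (Fin m → G) → Measure G) => h φ := by
  have hF : MeasurableSpace.CountablySeparated (finiteMeasures G) :=
    MeasurableSpace.countablySeparated_of_separatesPoints
  have : MeasurableSpace.CountablySeparated
      (Set.range (sumDirac : (Fin m → G) → Measure G)) := by
    rw [MeasurableSpace.CountablySeparated.subtype_iff] at hF ⊢
    refine hF.mono (fun _ => id) ?_
    rintro _ ⟨x, rfl⟩
    exact mem_finiteMeasures _
  exact (measurable_sumDirac m).measurable_comp_iff_restrict.1 hh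

/-- The set of finite sums of Dirac masses. -/
def pointMeasures (G : Type*) [MeasurableSpace G] : Set (Measure G) :=
  ⋃ m, Set.range (sumDirac : (Fin m → G) → Measure G)

theorem measurableSet_pointMeasures [TopologicalSpace G] [PolishSpace G]
    [MeasurableSpace G] [BorelSpace G] : MeasurableSet (pointMeasures G) :=
  MeasurableSet.iUnion fun m => measurableSet_range_sumDirac m

theorem sumDirac_mem_pointMeasures [MeasurableSpace G] {m : ℕ} (x : Fin m → G) :
    sumDirac x ∈ pointMeasures G :=
  Set.mem_iUnion.2 ⟨m, x, rfl⟩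

theorem aemeasurable_of_sumDirac [TopologicalSpace G] [PolishSpace G]
    [MeasurableSpace G] [BorelSpace G] {β : Type*} [MeasurableSpace β]
    {h : Measure G → β} (hh : ∀ m, Measurable fun x : Fin m → G => h (sumDirac x))
    {μ : Measure (Measure G)}
    (hμ : ∀ᵐ φ ∂μ, φ ∈ pointMeasures G) :
    AEMeasurable h μ := by
  rw [← Measure.restrict_eq_self_of_ae_mem hμ, pointMeasures, aemeasurable_iUnion_iff]
  exact fun m => aemeasurable_restrict_of_measurable_subtype (measurableSet_range_sumDirac m)
    (measurable_domRestrict_range_sumDirac (hh m))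

end PointMeasures

/-! ### Integration against `ifppLaw`. -/

section Law

variable {G : Type*}

theorem measurable_add_right_measure [MeasurableSpace G] {β : Type*} [MeasurableSpace β]
    {f g : β → Measure G} (hf : Measurable f) (hg : Measurable g) :
    Measurable fun b => f b + g b := by
  refine Measure.measurable_of_measurable_coe _ fun A hA => ?_
  simp only [Measure.coe_add, Pi.add_apply]
  exact ((Measure.measurable_coe hA).comp hf).add ((Measure.measurable_coe hA).comp hg)

instance isProbabilityMeasure_ifppLaw [MeasurableSpace G] (q : PMF ℕ) (ν : Measure G)
    [IsProbabilityMeasure ν] : IsProbabilityMeasure (ifppLaw q ν) := by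
  refine ⟨?_⟩
  rw [ifppLaw, Measure.sum_apply _ MeasurableSet.univ, ← q.tsum_coe]
  refine tsum_congr fun m => ?_
  rw [Measure.smul_apply, Measure.map_apply (measurable_sumDirac m) MeasurableSet.univ]
  simp

theorem ifppLaw_apply [MeasurableSpace G] (q : PMF ℕ) (ν : Measure G)
    {L : Set (Measure G)} (hL : MeasurableSet L) :
    ifppLaw q ν L =
      ∑' m, q m * Measure.pi (fun _ : Fin m => ν) (sumDirac ⁻¹' L) := by
  rw [ifppLaw, Measure.sum_apply _ hL]
  refine tsum_congr fun m => ?_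
  rw [Measure.smul_apply, Measure.map_apply (measurable_sumDirac m) hL]
  rfl

variable [TopologicalSpace G] [PolishSpace G] [MeasurableSpace G] [BorelSpace G]

theorem ae_map_mem_pointMeasures (m : ℕ) (μ : Measure (Fin m → G)) :
    ∀ᵐ φ ∂(μ.map sumDirac), φ ∈ pointMeasures G := by
  exact (ae_map_iff (measurable_sumDirac m).aemeasurable measurableSet_pointMeasures).2
    (Filter.Eventually.of_forall fun x => sumDirac_mem_pointMeasures x)

theorem ae_ifppLaw_mem_pointMeasures (q : PMF ℕ) (ν : Measure G) :
    ∀ᵐ φ ∂(ifppLaw q ν), φ ∈ pointMeasures G := by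
  refine (Measure.ae_sum_iff' measurableSet_pointMeasures).2 fun m => ?_
  exact Measure.ae_smul_measure (ae_map_mem_pointMeasures m _) _

theorem aemeasurable_ifppLaw {β : Type*} [MeasurableSpace β] {h : Measure G → β}
    (hh : ∀ m, Measurable fun x : Fin m → G => h (sumDirac x)) (q : PMF ℕ) (ν : Measure G) :
    AEMeasurable h (ifppLaw q ν) :=
  aemeasurable_of_sumDirac hh (ae_ifppLaw_mem_pointMeasures q ν)

/-- The integrand need only be measurable along each `sumDirac`, which allows integrands built from
`factorialPower`. -/
theorem lintegral_ifppLaw {h : Measure G → ℝ≥0∞}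
    (hh : ∀ m, Measurable fun x : Fin m → G => h (sumDirac x)) (q : PMF ℕ) (ν : Measure G) :
    ∫⁻ φ, h φ ∂(ifppLaw q ν) =
      ∑' m, q m * ∫⁻ x, h (sumDirac x) ∂(Measure.pi fun _ : Fin m => ν) := by
  rw [ifppLaw, lintegral_sum_measure]
  refine tsum_congr fun m => ?_
  rw [lintegral_smul_measure, lintegral_map'
    (aemeasurable_of_sumDirac hh (ae_map_mem_pointMeasures m _))
    (measurable_sumDirac m).aemeasurable]
  rfl

end Law

/-! ### Factorial moments and the biased law of the number of points. -/

section FactorialMoment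

/-- The unnormalised law of `M - k` under the `k`-th factorial bias of `M ∼ q`. -/
noncomputable def factorialWeight (q : PMF ℕ) (k n : ℕ) : ℝ≥0∞ :=
  q (n + k) * ((n + k).descFactorial k : ℝ≥0∞)

theorem factorialWeight_eq (q : PMF ℕ) (k n : ℕ) :
    factorialWeight q k n =
      q (n + k) * ((Nat.factorial (n + k) : ℝ≥0∞) / (Nat.factorial n : ℝ≥0∞)) := by
  have h := Nat.factorial_mul_descFactorial (Nat.le_add_left k n)
  rw [Nat.add_sub_cancel] at h
  rw [factorialWeight, ← h, Nat.cast_mul, mul_comm (n.factorial : ℝ≥0∞),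
    ENNReal.mul_div_cancel_right (by exact_mod_cast n.factorial_ne_zero)
      (ENNReal.natCast_ne_top _)]

theorem tsum_eq_tsum_nat_add {f : ℕ → ℝ≥0∞} {k : ℕ} (h : ∀ m < k, f m = 0) :
    ∑' m, f m = ∑' n, f (n + k) := by
  rw [← ENNReal.summable.sum_add_tsum_nat_add' (f := f) (k := k),
    Finset.sum_eq_zero fun m hm => h m (Finset.mem_range.1 hm), zero_add]

theorem factorialMoment_eq_tsum (q : PMF ℕ) (k : ℕ) :
    factorialMoment q k = ∑' n, factorialWeight q k n := by
  rw [factorialMoment, lintegral_countable']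
  simp_rw [PMF.toMeasure_apply_singleton q _ (measurableSet_singleton _)]
  rw [tsum_eq_tsum_nat_add (k := k) fun m hm => by simp [Nat.descFactorial_of_lt hm]]
  exact tsum_congr fun n => mul_comm _ _

/-- The law of `M - k` under the `k`-th factorial bias of `M ∼ q`. -/
noncomputable def reducedPMF (q : PMF ℕ) (k : ℕ) (h0 : factorialMoment q k ≠ 0)
    (hfin : factorialMoment q k ≠ ∞) : PMF ℕ :=
  PMF.normalize (factorialWeight q k) (factorialMoment_eq_tsum q k ▸ h0)
    (factorialMoment_eq_tsum q k ▸ hfin)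

theorem reducedPMF_apply (q : PMF ℕ) (k : ℕ) (h0 : factorialMoment q k ≠ 0)
    (hfin : factorialMoment q k ≠ ∞) (n : ℕ) :
    reducedPMF q k h0 hfin n = factorialWeight q k n / factorialMoment q k := by
  rw [reducedPMF, PMF.normalize_apply, factorialMoment_eq_tsum, div_eq_mul_inv]

theorem factorialMoment_mul_reducedPMF (q : PMF ℕ) (k : ℕ) (h0 : factorialMoment q k ≠ 0)
    (hfin : factorialMoment q k ≠ ∞) (n : ℕ) :
    factorialMoment q k * reducedPMF q k h0 hfin n = factorialWeight q k n := by
  rw [reducedPMF_apply, ENNReal.mul_div_cancel h0 hfin]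

end FactorialMoment

/-! ### Splitting an i.i.d. sample along an injection of labels. -/

section Campbell

variable {G : Type*}

/-- The complement of the range of `e` has exactly `n` elements; any enumeration of it completes
`e`. -/
theorem exists_equiv_sum_extending {k n : ℕ} (e : Fin k ↪ Fin (n + k)) :
    ∃ u : Fin k ⊕ Fin n ≃ Fin (n + k), ∀ i, u (Sum.inl i) = e i := by
  classical
  have hcard : Fintype.card ((Set.range e)ᶜ : Set (Fin (n + k))) = n := by
    rw [Fintype.card_compl_set, Set.card_range_of_injective e.injective]
    simp
  refine ⟨((Equiv.ofInjective e e.injective).sumCongr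
    (Fintype.equivFinOfCardEq hcard).symm).trans (Equiv.Set.sumCompl (Set.range e)), fun i => ?_⟩
  simp

theorem measurePreserving_split [MeasurableSpace G] {k n m : ℕ} (u : Fin k ⊕ Fin n ≃ Fin m)
    (ν : Measure G) [SigmaFinite ν] :
    MeasurePreserving
      (fun y : Fin m → G => ((fun i => y (u (Sum.inl i)), fun j => y (u (Sum.inr j))) :
        (Fin k → G) × (Fin n → G)))
      (Measure.pi fun _ => ν) ((Measure.pi fun _ => ν).prod (Measure.pi fun _ => ν)) := by
  have h1 := (measurePreserving_piCongrLeft (fun _ : Fin m => ν) u).symm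
  have h2 := measurePreserving_sumPiEquivProdPi (fun _ : Fin k ⊕ Fin n => ν)
  exact h2.comp h1

theorem sumDirac_split [MeasurableSpace G] {k n m : ℕ} (u : Fin k ⊕ Fin n ≃ Fin m)
    (y : Fin m → G) :
    sumDirac y = sumDirac (fun i => y (u (Sum.inl i))) + sumDirac (fun j => y (u (Sum.inr j))) := by
  simp only [sumDirac]
  rw [← u.sum_comp, Fintype.sum_sum_type]

theorem factorialPower_sumDirac [MeasurableSpace G] [MeasurableSingletonClass G] (k : ℕ) {m : ℕ}
    (y : Fin m → G) :
    factorialPower k (sumDirac y) = ∑ e : Fin k ↪ Fin m, Measure.dirac (fun j => y (e j)) := by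
  rw [sumDirac, ← Measure.sum_fintype, factorialPower_sum_dirac, Measure.sum_fintype]

theorem factorialPower_sumDirac_apply [MeasurableSpace G] [MeasurableSingletonClass G] (k : ℕ)
    {m : ℕ} (y : Fin m → G) (s : Set (Fin k → G)) :
    factorialPower k (sumDirac y) s =
      ∑ e : Fin k ↪ Fin m, s.indicator 1 (fun j => y (e j)) := by
  rw [factorialPower_sumDirac, Measure.coe_finsetSum, Finset.sum_apply]
  simp_rw [Measure.dirac_apply]

variable [MeasurableSpace G] {k : ℕ} {s : Measure G → Set (Fin k → G)}
  {T : Set ((Fin k → G) × Measure G)}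

theorem measurableSet_preimage_sumDirac (hT : MeasurableSet T) (n : ℕ) :
    MeasurableSet (Prod.map id (sumDirac : (Fin n → G) → Measure G) ⁻¹' T) :=
  measurableSet_preimage (measurable_id.prodMap (measurable_sumDirac n)) hT

theorem indicator_sumDirac_split
    (hs : ∀ x n (z : Fin n → G), x ∈ s (sumDirac x + sumDirac z) ↔ (x, sumDirac z) ∈ T)
    {n m : ℕ} (u : Fin k ⊕ Fin n ≃ Fin m) (y : Fin m → G) :
    (s (sumDirac y)).indicator (1 : (Fin k → G) → ℝ≥0∞) (fun j => y (u (Sum.inl j))) =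
      (Prod.map id (sumDirac : (Fin n → G) → Measure G) ⁻¹' T).indicator 1
        (fun i => y (u (Sum.inl i)), fun j => y (u (Sum.inr j))) := by
  classical
  rw [sumDirac_split u y, Set.indicator_apply, Set.indicator_apply]
  simp only [hs, Set.mem_preimage, Prod.map_apply, id, Pi.one_apply]

-- The set `s φ` may depend on `φ`, but after splitting off `x` it must become a condition `T` on
-- `x` and the remaining points. Moment measures, reduced Campbell measures and ordinary ones are
-- all instances.
variable (hs : ∀ x n (z : Fin n → G), x ∈ s (sumDirac x + sumDirac z) ↔ (x, sumDirac z) ∈ T)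
  (hT : MeasurableSet T)

include hs hT

theorem measurable_indicator_sumDirac {m : ℕ} (e : Fin k ↪ Fin m) :
    Measurable fun y : Fin m → G =>
      (s (sumDirac y)).indicator (1 : (Fin k → G) → ℝ≥0∞) (fun j => y (e j)) := by
  obtain ⟨n, rfl⟩ : ∃ n, m = n + k :=
    ⟨m - k, (Nat.sub_add_cancel (by simpa using Fintype.card_le_of_embedding e)).symm⟩
  obtain ⟨u, hu⟩ := exists_equiv_sum_extending e
  simp_rw [← hu, indicator_sumDirac_split hs u]
  refine (measurable_one.indicator (measurableSet_preimage_sumDirac hT n)).comp ?_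
  fun_prop

/-- By exchangeability the value does not depend on `e`, so summing over injections only contributes
the factor `(n + k).descFactorial k`. -/
theorem lintegral_indicator_sumDirac {n : ℕ} (e : Fin k ↪ Fin (n + k)) (ν : Measure G)
    [SigmaFinite ν] :
    ∫⁻ y, (s (sumDirac y)).indicator 1 (fun j => y (e j)) ∂(Measure.pi fun _ => ν) =
      ((Measure.pi fun _ => ν).prod (Measure.pi fun _ => ν))
        (Prod.map id (sumDirac : (Fin n → G) → Measure G) ⁻¹' T) := by
  obtain ⟨u, hu⟩ := exists_equiv_sum_extending e
  simp_rw [← hu, indicator_sumDirac_split hs u]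
  have hm := measurableSet_preimage_sumDirac hT n
  rw [(measurePreserving_split u ν).lintegral_comp (measurable_one.indicator hm),
    lintegral_indicator_one hm]

variable [MeasurableSingletonClass G]

theorem measurable_factorialPower_sumDirac (m : ℕ) :
    Measurable fun y : Fin m → G => factorialPower k (sumDirac y) (s (sumDirac y)) := by
  simp_rw [factorialPower_sumDirac_apply]
  exact Finset.measurable_sum _ fun e _ => measurable_indicator_sumDirac hs hT e

theorem lintegral_factorialPower_sumDirac (n : ℕ) (ν : Measure G) [SigmaFinite ν] :
    ∫⁻ y, factorialPower k (sumDirac y) (s (sumDirac y)) ∂(Measure.pi fun _ : Fin (n + k) => ν) =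
      (n + k).descFactorial k * ((Measure.pi fun _ => ν).prod (Measure.pi fun _ => ν))
        (Prod.map id (sumDirac : (Fin n → G) → Measure G) ⁻¹' T) := by
  simp_rw [factorialPower_sumDirac_apply]
  rw [lintegral_finsetSum _ fun e _ => measurable_indicator_sumDirac hs hT e]
  simp_rw [lintegral_indicator_sumDirac hs hT]
  simp [Fintype.card_embedding_eq]

end Campbell

/-! ### The reduced Campbell formula. -/

section CampbellFormula

variable {G : Type*} [TopologicalSpace G] [PolishSpace G] [MeasurableSpace G] [BorelSpace G]
  {k : ℕ} {s : Measure G → Set (Fin k → G)} {T : Set ((Fin k → G) × Measure G)}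

/-- The reduced Campbell formula for the law `IFPP(q, ν)`. -/
theorem lintegral_factorialPower_ifppLaw
    (hs : ∀ x n (z : Fin n → G), x ∈ s (sumDirac x + sumDirac z) ↔ (x, sumDirac z) ∈ T)
    (hT : MeasurableSet T)
    (q : PMF ℕ) (ν : Measure G) [IsProbabilityMeasure ν] (h0 : factorialMoment q k ≠ 0)
    (hfin : factorialMoment q k ≠ ∞) :
    ∫⁻ φ, factorialPower k φ (s φ) ∂(ifppLaw q ν) =
      factorialMoment q k * ∫⁻ x, ifppLaw (reducedPMF q k h0 hfin) ν
        (Prod.mk x ⁻¹' T) ∂(Measure.pi fun _ => ν) := by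
  rw [lintegral_ifppLaw (measurable_factorialPower_sumDirac hs hT), tsum_eq_tsum_nat_add (k := k)]
  · simp_rw [fun x => ifppLaw_apply (reducedPMF q k h0 hfin) ν (measurable_prodMk_left (x := x) hT)]
    have hm : ∀ n, Measurable fun x =>
        Measure.pi (fun _ : Fin n => ν) (sumDirac ⁻¹' (Prod.mk x ⁻¹' T)) := fun n =>
      measurable_measure_prodMk_left (measurableSet_preimage_sumDirac hT n)
    rw [lintegral_tsum fun n => ((hm n).const_mul _).aemeasurable, ← ENNReal.tsum_mul_left]
    refine tsum_congr fun n => ?_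
    rw [lintegral_factorialPower_sumDirac hs hT,
      Measure.prod_apply (measurableSet_preimage_sumDirac hT n)]
    refine Eq.trans ?_ (congrArg _ (lintegral_const_mul _ (hm n)).symm)
    rw [← mul_assoc, ← mul_assoc, factorialMoment_mul_reducedPMF]
    rfl
  · intro m hm
    have : IsEmpty (Fin k ↪ Fin m) := ⟨fun e =>
      absurd (Fintype.card_le_of_embedding e) (by simpa using hm)⟩
    simp_rw [factorialPower_sumDirac_apply]
    simp

end CampbellFormula

/-! ### Almost sure uniqueness of disintegrations. -/

section KernelUniqueness

variable {X G : Type*} [MeasurableSpace X] [MeasurableSpace G]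

open Classical in
/-- The retraction of the space of measures onto the finite measures sending every infinite
measure to `0`. -/
noncomputable def toFinite (φ : Measure G) : finiteMeasures G :=
  ⟨if φ ∈ finiteMeasures G then φ else 0, by
    split_ifs with h
    exacts [h, mem_finiteMeasures 0]⟩

theorem measurable_toFinite : Measurable (toFinite : Measure G → finiteMeasures G) := by
  classical
  exact Measurable.subtype_mk
    (Measurable.ite measurableSet_finiteMeasures measurable_id measurable_const)

theorem map_toFinite_map_coe {μ : Measure (Measure G)} (h : μ (finiteMeasures G)ᶜ = 0) :
    (μ.map toFinite).map Subtype.val = μ := by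
  rw [Measure.map_map measurable_subtype_coe measurable_toFinite]
  have : (Subtype.val ∘ toFinite : Measure G → Measure G) =ᵐ[μ] id := by
    have h' : ∀ᵐ φ ∂μ, φ ∈ finiteMeasures G := h
    filter_upwards [h'] with φ hφ
    simp [toFinite, hφ]
  rw [Measure.map_congr this, Measure.map_id]

/-- Two probability kernels of measures with the same integrals agree almost everywhere if one of
them is concentrated on finite measures. -/
theorem kernel_ae_eq_of_forall_setLIntegral_eq [MeasurableSpace.CountablyGenerated G]
    {μ : Measure X} [IsFiniteMeasure μ] (κ η : Kernel X (Measure G)) [IsMarkovKernel κ]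
    [IsMarkovKernel η]
    (h : ∀ B L, MeasurableSet B → MeasurableSet L →
      ∫⁻ x in B, κ x L ∂μ = ∫⁻ x in B, η x L ∂μ)
    (hη : ∀ x, η x (finiteMeasures G)ᶜ = 0) :
    ∀ᵐ x ∂μ, κ x = η x := by
  have hF : MeasurableSet (finiteMeasures G)ᶜ := measurableSet_finiteMeasures.compl
  -- Testing against the infinite measures shows that `κ` is a.e. concentrated on finite ones too.
  -- Both kernels can then be pushed to `finiteMeasures G`, whose σ-algebra is countably generated,
  -- and recovered from there.
  have hκ : ∀ᵐ x ∂μ, κ x (finiteMeasures G)ᶜ = 0 := by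
    have := h Set.univ _ MeasurableSet.univ hF
    simp only [hη, lintegral_zero, Measure.restrict_univ] at this
    exact (lintegral_eq_zero_iff (κ.measurable_coe hF)).1 this
  have := Kernel.IsMarkovKernel.map κ (measurable_toFinite (G := G))
  have := Kernel.IsMarkovKernel.map η (measurable_toFinite (G := G))
  have heq : μ ⊗ₘ κ.map toFinite = μ ⊗ₘ η.map toFinite := by
    refine Measure.ext_prod fun {B L} hB hL => ?_
    rw [Measure.compProd_apply_prod hB hL, Measure.compProd_apply_prod hB hL]
    simp_rw [Kernel.map_apply' _ measurable_toFinite _ hL]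
    exact h B _ hB (measurable_toFinite hL)
  filter_upwards [Kernel.ae_eq_of_compProd_eq heq, hκ] with x hx hκx
  rw [← map_toFinite_map_coe hκx, ← map_toFinite_map_coe (hη x),
    ← Kernel.map_apply _ measurable_toFinite, ← Kernel.map_apply _ measurable_toFinite, hx]

end KernelUniqueness

/-! ### The candidate Palm kernel at tuples with distinct coordinates. -/

section ShiftKernel

variable {G : Type*} [MeasurableSpace G]

theorem measurable_sumDirac_add {k : ℕ} (x : Fin k → G) :
    Measurable fun ψ : Measure G => sumDirac x + ψ :=
  measurable_add_right_measure measurable_const measurable_id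

/-- The kernel `x ↦ law of ∑ⱼ δ_{xⱼ} + Ψ` for `Ψ ∼ μ`. -/
noncomputable def shiftKernel (k : ℕ) (μ : Measure (Measure G)) [SFinite μ] :
    Kernel (Fin k → G) (Measure G) where
  toFun x := μ.map fun ψ => sumDirac x + ψ
  measurable' := by
    refine Measure.measurable_of_measurable_coe _ fun L hL => ?_
    have h : Measurable fun p : (Fin k → G) × Measure G => sumDirac p.1 + p.2 :=
      measurable_add_right_measure ((measurable_sumDirac k).comp measurable_fst) measurable_snd
    have hmap : ∀ x : Fin k → G, μ.map (fun ψ => sumDirac x + ψ) L =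
        μ (Prod.mk x ⁻¹' ((fun p : (Fin k → G) × Measure G => sumDirac p.1 + p.2) ⁻¹' L)) :=
      fun x => Measure.map_apply (measurable_sumDirac_add x) hL
    simp_rw [hmap]
    exact measurable_measure_prodMk_left (h hL)

theorem shiftKernel_apply (k : ℕ) (μ : Measure (Measure G)) [SFinite μ] (x : Fin k → G) :
    shiftKernel k μ x = μ.map fun ψ => sumDirac x + ψ := rfl

instance isMarkovKernel_shiftKernel (k : ℕ) (μ : Measure (Measure G)) [IsProbabilityMeasure μ] :
    IsMarkovKernel (shiftKernel k μ) :=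
  ⟨fun x => Measure.isProbabilityMeasure_map (measurable_sumDirac_add x).aemeasurable⟩

theorem shiftKernel_compl_finiteMeasures (k : ℕ) {μ : Measure (Measure G)} [SFinite μ]
    (h : μ (finiteMeasures G)ᶜ = 0) (x : Fin k → G) :
    shiftKernel k μ x (finiteMeasures G)ᶜ = 0 := by
  rw [shiftKernel_apply, Measure.map_apply (measurable_sumDirac_add x)
    measurableSet_finiteMeasures.compl]
  refine measure_mono_null (Set.compl_subset_compl.2 fun ψ (hψ' : ψ Set.univ < ∞) => ?_) h
  have : IsFiniteMeasure ψ := ⟨hψ'⟩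
  exact mem_finiteMeasures (sumDirac x + ψ)

end ShiftKernel

/-! ### Ordinary powers, factorial powers and removal of distinct atoms. -/

section Power

variable {G : Type*} [MeasurableSpace G]

theorem power_sumDirac (k : ℕ) {m : ℕ} (y : Fin m → G) :
    power k (sumDirac y) = ∑ e : Fin k → Fin m, Measure.dirac (fun j => y (e j)) := by
  classical
  refine Measure.pi_eq fun s hs => ?_
  simp only [sumDirac, Measure.coe_finsetSum, Finset.sum_apply]
  rw [Finset.prod_univ_sum, Fintype.piFinset_univ]
  refine Finset.sum_congr rfl fun e _ => ?_
  rw [Measure.dirac_apply' _ (MeasurableSet.univ_pi hs)]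
  simp_rw [fun j => Measure.dirac_apply' (y (e j)) (hs j)]
  simp only [Set.indicator_apply, Pi.one_apply, Set.mem_univ_pi]
  by_cases h : ∀ i, y (e i) ∈ s i
  · simp [h]
  · rw [if_neg h]
    obtain ⟨i, hi⟩ := not_forall.1 h
    exact (Finset.prod_eq_zero (Finset.mem_univ i) (if_neg hi)).symm

variable [MeasurableSingletonClass G]

theorem power_sumDirac_apply (k : ℕ) {m : ℕ} (y : Fin m → G) (s : Set (Fin k → G)) :
    power k (sumDirac y) s = ∑ e : Fin k → Fin m, s.indicator 1 (fun j => y (e j)) := by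
  rw [power_sumDirac, Measure.coe_finsetSum, Finset.sum_apply]
  simp_rw [Measure.dirac_apply]

theorem measurable_power_sumDirac (k m : ℕ) :
    Measurable fun y : Fin m → G => power k (sumDirac y) := by
  refine Measure.measurable_of_measurable_coe _ fun B hB => ?_
  simp_rw [power_sumDirac_apply]
  refine Finset.measurable_sum _ fun e _ => (measurable_one.indicator hB).comp ?_
  fun_prop

/-- The two sums differ by the non-injective index maps, whose tuples have a repeated coordinate and
so miss `s`. The points of `y` themselves may coincide. -/
theorem power_sumDirac_eq_factorialPower (k : ℕ) {m : ℕ} (y : Fin m → G)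
    {s : Set (Fin k → G)} (hs : s ⊆ {x | Function.Injective x}) :
    power k (sumDirac y) s = factorialPower k (sumDirac y) s := by
  classical
  rw [power_sumDirac_apply, factorialPower_sumDirac_apply]
  refine (Fintype.sum_of_injective (fun e : Fin k ↪ Fin m => (e : Fin k → Fin m))
    DFunLike.coe_injective _ _ (fun e he => ?_) fun e => rfl).symm
  refine Set.indicator_of_notMem (fun hmem => he ?_) _
  exact ⟨⟨e, fun i j hij => hs hmem (congrArg y hij)⟩, rfl⟩

theorem sumDirac_le_of_injective {k : ℕ} {x : Fin k → G} (hx : Function.Injective x)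
    {φ : Measure G} (h : ∀ j, 1 ≤ φ {x j}) : sumDirac x ≤ φ := by
  classical
  refine Measure.le_iff.2 fun A hA => ?_
  simp only [sumDirac, Measure.coe_finsetSum, Finset.sum_apply, Measure.dirac_apply,
    Set.indicator_apply, Pi.one_apply]
  rw [← Finset.sum_filter]
  calc ∑ j with x j ∈ A, (1 : ℝ≥0∞) ≤ ∑ j with x j ∈ A, φ {x j} :=
        Finset.sum_le_sum fun j _ => h j
    _ = φ (⋃ j ∈ Finset.univ.filter (fun j => x j ∈ A), {x j}) :=
        (measure_biUnion_finset (fun i _ j _ hij => by simpa using hx.ne hij)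
          fun j _ => measurableSet_singleton _).symm
    _ ≤ φ A := measure_mono (by
        simp only [Set.iUnion_subset_iff, Set.singleton_subset_iff]
        exact fun j hj => (Finset.mem_filter.1 hj).2)

theorem one_le_sumDirac_singleton {k : ℕ} (x : Fin k → G) (j : Fin k) :
    1 ≤ sumDirac x {x j} := by
  simp only [sumDirac, Measure.coe_finsetSum, Finset.sum_apply]
  refine le_trans ?_ (Finset.single_le_sum (f := fun i => Measure.dirac (x i) {x j})
    (fun _ _ => zero_le) (Finset.mem_univ j))
  simp

/-- Adding then subtracting a finite measure is the identity; the issue is measurability of the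
subtraction. On the event that every `x j` has mass at least `1`, distinctness gives `sumDirac x ≤
φ`, so subtraction is setwise there. -/
theorem map_sumDirac_add_map_sub {k : ℕ} {x : Fin k → G} (hx : Function.Injective x)
    (μ : Measure (Measure G)) :
    (μ.map (fun ψ => sumDirac x + ψ)).map (fun φ => φ - sumDirac x) = μ := by
  have hadd := measurable_sumDirac_add x
  have hE : MeasurableSet {φ : Measure G | ∀ j, 1 ≤ φ {x j}} := by
    rw [Set.ofPred_forall]
    exact MeasurableSet.iInter fun j =>
      Measure.measurable_coe (measurableSet_singleton _) measurableSet_Ici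
  have hmem : ∀ᵐ φ ∂(μ.map fun ψ => sumDirac x + ψ), φ ∈ {φ : Measure G | ∀ j, 1 ≤ φ {x j}} :=
    (ae_map_iff hadd.aemeasurable hE).2 (Filter.Eventually.of_forall fun ψ j =>
      (one_le_sumDirac_singleton x j).trans (Measure.le_add_right le_rfl _))
  have hsub : AEMeasurable (fun φ : Measure G => φ - sumDirac x)
      (μ.map fun ψ => sumDirac x + ψ) := by
    rw [← Measure.restrict_eq_self_of_ae_mem hmem]
    refine aemeasurable_restrict_of_measurable_subtype hE
      (Measure.measurable_of_measurable_coe _ fun A hA => ?_)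
    simp_rw [fun φ : {φ : Measure G | ∀ j, 1 ≤ φ {x j}} =>
      Measure.sub_apply hA (sumDirac_le_of_injective hx φ.2)]
    exact ((Measure.measurable_coe hA).comp measurable_subtype_coe).sub measurable_const
  rw [AEMeasurable.map_map_of_aemeasurable hsub hadd.aemeasurable]
  have : ((fun φ : Measure G => φ - sumDirac x) ∘ fun ψ => sumDirac x + ψ) = id := by
    funext ψ
    simp only [Function.comp_apply, id]
    rw [add_comm, Measure.add_sub_cancel]
  rw [this, Measure.map_id]

end Power

/-! ### Identification of the moment measures and the Palm kernels. -/

section Main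

variable {Ω G : Type*} [MeasurableSpace Ω] [TopologicalSpace G] [PolishSpace G]
  [MeasurableSpace G] [BorelSpace G]

theorem measurableSet_injective (k : ℕ) : MeasurableSet {x : Fin k → G | Function.Injective x} := by
  simp only [Function.Injective, Set.ofPred_forall]
  refine MeasurableSet.iInter fun i => MeasurableSet.iInter fun j => ?_
  by_cases hij : i = j
  · simp [hij]
  · simp only [hij, imp_false]
    exact (measurableSet_eq_fun (measurable_pi_apply i) (measurable_pi_apply j)).compl

variable {P : Measure Ω} {q : PMF ℕ} {ν : Measure G} {Φ : Ω → Measure G}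

theorem lintegral_comp_of_hasLaw (hΦ : HasLaw Φ (ifppLaw q ν) P) {h : Measure G → ℝ≥0∞}
    (hh : ∀ m, Measurable fun x : Fin m → G => h (sumDirac x)) :
    ∫⁻ ω, h (Φ ω) ∂P = ∫⁻ φ, h φ ∂(ifppLaw q ν) := by
  have := aemeasurable_ifppLaw hh q ν
  rw [← hΦ.map_eq] at this ⊢
  exact (lintegral_map' this hΦ.aemeasurable).symm

theorem aemeasurable_comp_of_hasLaw (hΦ : HasLaw Φ (ifppLaw q ν) P) {β : Type*}
    [MeasurableSpace β] {h : Measure G → β}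
    (hh : ∀ m, Measurable fun x : Fin m → G => h (sumDirac x)) :
    AEMeasurable (fun ω => h (Φ ω)) P := by
  have := aemeasurable_ifppLaw hh q ν
  rw [← hΦ.map_eq] at this
  exact this.comp_aemeasurable hΦ.aemeasurable

theorem ae_mem_pointMeasures_of_hasLaw (hΦ : HasLaw Φ (ifppLaw q ν) P) :
    ∀ᵐ ω ∂P, Φ ω ∈ pointMeasures G := by
  have := ae_ifppLaw_mem_pointMeasures q ν
  rw [← hΦ.map_eq] at this
  exact ae_of_ae_map hΦ.aemeasurable this

theorem measurable_factorialPower_sumDirac_measure (k m : ℕ) :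
    Measurable fun y : Fin m → G => factorialPower k (sumDirac y) :=
  Measure.measurable_of_measurable_coe _ fun B hB =>
    measurable_factorialPower_sumDirac (s := fun _ => B) (T := B ×ˢ Set.univ)
      (fun x n z => by simp) (hB.prod MeasurableSet.univ) m

variable {k : ℕ}

theorem lintegral_power_eq_factorialPower (hΦ : HasLaw Φ (ifppLaw q ν) P)
    {s : Measure G → Set (Fin k → G)} (hs : ∀ φ, s φ ⊆ {x | Function.Injective x}) :
    ∫⁻ ω, power k (Φ ω) (s (Φ ω)) ∂P = ∫⁻ ω, factorialPower k (Φ ω) (s (Φ ω)) ∂P := by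
  refine lintegral_congr_ae ?_
  filter_upwards [ae_mem_pointMeasures_of_hasLaw hΦ] with ω hω
  obtain ⟨m, x, hx⟩ := Set.mem_iUnion.1 hω
  rw [← hx]
  exact power_sumDirac_eq_factorialPower k x (hs _)

variable [IsProbabilityMeasure ν]

theorem factorialMomentMeasure_eq (hΦ : HasLaw Φ (ifppLaw q ν) P)
    (h0 : factorialMoment q k ≠ 0) (hfin : factorialMoment q k ≠ ∞) :
    factorialMomentMeasure P Φ k = factorialMoment q k • Measure.pi (fun _ => ν) := by
  refine Measure.ext fun B hB => ?_
  have hT : MeasurableSet (B ×ˢ (Set.univ : Set (Measure G))) := hB.prod MeasurableSet.univ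
  have hs : ∀ (x : Fin k → G) n (z : Fin n → G), x ∈ B ↔ (x, sumDirac z) ∈ B ×ˢ Set.univ := by
    simp
  rw [factorialMomentMeasure, Measure.bind_apply hB
      (aemeasurable_comp_of_hasLaw hΦ (measurable_factorialPower_sumDirac_measure k)),
    lintegral_comp_of_hasLaw hΦ (h := fun φ => factorialPower k φ B)
      (measurable_factorialPower_sumDirac (s := fun _ => B) hs hT),
    lintegral_factorialPower_ifppLaw (s := fun _ => B) hs hT q ν h0 hfin, Measure.smul_apply, smul_eq_mul,
    ← lintegral_indicator_one hB]
  congr 1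
  refine lintegral_congr fun x => ?_
  by_cases hx : x ∈ B <;> simp [hx]

theorem reducedCampbell_eq (hΦ : HasLaw Φ (ifppLaw q ν) P)
    (h0 : factorialMoment q k ≠ 0) (hfin : factorialMoment q k ≠ ∞)
    {B : Set (Fin k → G)} {L : Set (Measure G)} (hB : MeasurableSet B) (hL : MeasurableSet L) :
    reducedCampbell P Φ k B L =
      ∫⁻ _ in B, ifppLaw (reducedPMF q k h0 hfin) ν L ∂(factorialMomentMeasure P Φ k) := by
  have hT := hB.prod hL
  have hs : ∀ (x : Fin k → G) n (z : Fin n → G),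
      x ∈ B ∩ {x' | sumDirac x + sumDirac z - sumDirac x' ∈ L} ↔ (x, sumDirac z) ∈ B ×ˢ L := by
    intro x n z
    -- Subtracting the finite measure `sumDirac x` from the sum returns `sumDirac z` exactly, so the
    -- condition becomes membership in `B ×ˢ L`.
    simp [add_comm (sumDirac x)]
  rw [reducedCampbell, factorialMomentMeasure_eq hΦ h0 hfin,
    lintegral_comp_of_hasLaw hΦ (h := fun φ => factorialPower k φ (B ∩ {x | φ - sumDirac x ∈ L}))
      (measurable_factorialPower_sumDirac (s := fun φ => B ∩ {x | φ - sumDirac x ∈ L}) hs hT),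
    lintegral_factorialPower_ifppLaw (s := fun φ => B ∩ {x | φ - sumDirac x ∈ L}) hs hT q ν h0 hfin,
    Measure.restrict_smul, lintegral_smul_measure, smul_eq_mul, ← lintegral_indicator hB]
  congr 1
  refine lintegral_congr fun x => ?_
  by_cases hx : x ∈ B <;> simp [hx]

theorem isReducedPalmKernel_const (hΦ : HasLaw Φ (ifppLaw q ν) P)
    (h0 : factorialMoment q k ≠ 0) (hfin : factorialMoment q k ≠ ∞) :
    IsReducedPalmKernel P Φ k (Kernel.const _ (ifppLaw (reducedPMF q k h0 hfin) ν)) :=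
  ⟨inferInstance, fun _ _ hB hL => by
    simpa only [Kernel.const_apply] using reducedCampbell_eq hΦ h0 hfin hB hL⟩

theorem ifppLaw_compl_finiteMeasures (q : PMF ℕ) (ν : Measure G) :
    ifppLaw q ν (finiteMeasures G)ᶜ = 0 := by
  have : ∀ᵐ φ ∂(ifppLaw q ν), φ ∈ finiteMeasures G := by
    filter_upwards [ae_ifppLaw_mem_pointMeasures q ν] with φ hφ
    obtain ⟨m, x, rfl⟩ := Set.mem_iUnion.1 hφ
    exact mem_finiteMeasures _
  exact this

theorem IsReducedPalmKernel.ae_eq (hΦ : HasLaw Φ (ifppLaw q ν) P)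
    (h0 : factorialMoment q k ≠ 0) (hfin : factorialMoment q k ≠ ∞)
    {κ : Kernel (Fin k → G) (Measure G)} (hκ : IsReducedPalmKernel P Φ k κ) :
    ∀ᵐ x ∂(factorialMomentMeasure P Φ k), κ x = ifppLaw (reducedPMF q k h0 hfin) ν := by
  have := hκ.1
  have : IsFiniteMeasure (factorialMomentMeasure P Φ k) := by
    rw [factorialMomentMeasure_eq hΦ h0 hfin]
    exact Measure.smul_finite _ hfin
  refine kernel_ae_eq_of_forall_setLIntegral_eq κ
    (Kernel.const _ (ifppLaw (reducedPMF q k h0 hfin) ν)) (fun B L hB hL => ?_)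
    fun x => ifppLaw_compl_finiteMeasures _ ν
  rw [← hκ.2 B L hB hL, (isReducedPalmKernel_const hΦ h0 hfin).2 B L hB hL]

theorem momentMeasure_restrict_injective (hΦ : HasLaw Φ (ifppLaw q ν) P)
    (h0 : factorialMoment q k ≠ 0) (hfin : factorialMoment q k ≠ ∞) :
    (momentMeasure P Φ k).restrict {x | Function.Injective x} =
      factorialMoment q k •
        (Measure.pi fun _ => ν).restrict {x : Fin k → G | Function.Injective x} := by
  rw [← Measure.restrict_smul, ← factorialMomentMeasure_eq hΦ h0 hfin]
  refine Measure.ext fun B hB => ?_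
  have hBI := hB.inter (measurableSet_injective (G := G) k)
  rw [Measure.restrict_apply hB, Measure.restrict_apply hB, momentMeasure, factorialMomentMeasure,
    Measure.bind_apply hBI (aemeasurable_comp_of_hasLaw hΦ (measurable_power_sumDirac k)),
    Measure.bind_apply hBI
      (aemeasurable_comp_of_hasLaw hΦ (measurable_factorialPower_sumDirac_measure k))]
  exact lintegral_power_eq_factorialPower hΦ (s := fun _ => B ∩ {x | Function.Injective x})
    fun _ => Set.inter_subset_right

/-- Off the diagonals `power` may be replaced by `factorialPower`; the Campbell formula then applies
with `T` the condition that the chosen points lie in `B` and the recombined configuration in `L`. -/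
theorem campbell_eq_of_subset_injective (hΦ : HasLaw Φ (ifppLaw q ν) P)
    (h0 : factorialMoment q k ≠ 0) (hfin : factorialMoment q k ≠ ∞)
    {B : Set (Fin k → G)} {L : Set (Measure G)} (hB : MeasurableSet B) (hL : MeasurableSet L)
    (hBI : B ⊆ {x | Function.Injective x}) :
    campbell P Φ k B L = factorialMoment q k *
      ∫⁻ x in B, shiftKernel k (ifppLaw (reducedPMF q k h0 hfin) ν) x L
        ∂(Measure.pi fun _ => ν) := by
  have hadd : Measurable fun p : (Fin k → G) × Measure G => sumDirac p.1 + p.2 :=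
    measurable_add_right_measure ((measurable_sumDirac k).comp measurable_fst) measurable_snd
  have hT : MeasurableSet (Prod.fst ⁻¹' B ∩
      (fun p : (Fin k → G) × Measure G => sumDirac p.1 + p.2) ⁻¹' L) :=
    (measurable_fst hB).inter (hadd hL)
  have hs : ∀ (x : Fin k → G) n (z : Fin n → G),
      x ∈ B ∩ {_x | sumDirac x + sumDirac z ∈ L} ↔ (x, sumDirac z) ∈ Prod.fst ⁻¹' B ∩
        (fun p : (Fin k → G) × Measure G => sumDirac p.1 + p.2) ⁻¹' L :=
    fun _ _ _ => Iff.rfl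
  rw [campbell, lintegral_power_eq_factorialPower hΦ (s := fun φ => B ∩ {_x | φ ∈ L})
      fun _ => Set.inter_subset_left.trans hBI,
    lintegral_comp_of_hasLaw hΦ (h := fun φ => factorialPower k φ (B ∩ {_x | φ ∈ L}))
      (measurable_factorialPower_sumDirac (s := fun φ => B ∩ {_x | φ ∈ L}) hs hT),
    lintegral_factorialPower_ifppLaw (s := fun φ => B ∩ {_x | φ ∈ L}) hs hT q ν h0 hfin,
    ← lintegral_indicator hB]
  congr 1
  refine lintegral_congr fun x => ?_
  by_cases hx : x ∈ B
  · rw [Set.indicator_of_mem hx, shiftKernel_apply,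
      Measure.map_apply (measurable_sumDirac_add x) hL]
    congr 1
    ext ψ
    simp [hx]
  · rw [Set.indicator_of_notMem hx]
    refine measure_mono_null (fun ψ hψ => hx hψ.1) measure_empty

theorem IsPalmKernel.ae_map_sub_eq (hΦ : HasLaw Φ (ifppLaw q ν) P)
    (h0 : factorialMoment q k ≠ 0) (hfin : factorialMoment q k ≠ ∞)
    {κ : Kernel (Fin k → G) (Measure G)} (hκ : IsPalmKernel P Φ k κ) :
    ∀ᵐ x ∂(momentMeasure P Φ k), Function.Injective x →
      (κ x).map (fun φ => φ - sumDirac x) = ifppLaw (reducedPMF q k h0 hfin) ν := by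
  have := hκ.1
  have hI := measurableSet_injective (G := G) k
  have hrestrict := momentMeasure_restrict_injective hΦ h0 hfin
  have : IsFiniteMeasure
      ((momentMeasure P Φ k).restrict {x : Fin k → G | Function.Injective x}) := by
    rw [hrestrict]
    exact Measure.smul_finite _ hfin
  have hae : ∀ᵐ x ∂((momentMeasure P Φ k).restrict {x : Fin k → G | Function.Injective x}),
      κ x = shiftKernel k (ifppLaw (reducedPMF q k h0 hfin) ν) x := by
    -- Uniqueness is applied to the moment measure restricted to injective tuples, where it equals
    -- the finite measure `E[M^(k)] • ν^k`.
    refine kernel_ae_eq_of_forall_setLIntegral_eq κ _ (fun B L hB hL => ?_)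
      (shiftKernel_compl_finiteMeasures k (ifppLaw_compl_finiteMeasures _ ν))
    have hκB := hκ.2 _ L (hB.inter hI) hL
    rw [campbell_eq_of_subset_injective hΦ h0 hfin (hB.inter hI) hL Set.inter_subset_right] at hκB
    rw [Measure.restrict_restrict hB, ← hκB, ← Measure.restrict_restrict hB,
      ← Measure.restrict_restrict hB, hrestrict, Measure.restrict_smul, lintegral_smul_measure,
      smul_eq_mul]
  filter_upwards [(ae_restrict_iff' hI).1 hae] with x hx hinj
  rw [hx hinj, shiftKernel_apply, map_sumDirac_add_map_sub hinj]

end Main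

end IFPP

theorem theoremS1 {Ω G : Type*} [MeasurableSpace Ω] [TopologicalSpace G] [PolishSpace G]
    [MeasurableSpace G] [BorelSpace G] (P : Measure Ω) [IsProbabilityMeasure P]
    (q : PMF ℕ) (ν : Measure G) [IsProbabilityMeasure ν]
    (Φ : Ω → Measure G) (hΦ : HasLaw Φ (IFPP.ifppLaw q ν) P)
    (k : ℕ) (hpos : IFPP.factorialMoment q k ≠ 0) (hfin : IFPP.factorialMoment q k ≠ ∞) :
    IFPP.factorialMoment q k = ∑' m : ℕ, q (m + k) * ((Nat.factorial (m + k) : ℝ≥0∞) / (Nat.factorial m : ℝ≥0∞)) ∧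
    ∃ q' : PMF ℕ,
      (∀ m : ℕ, q' m =
        q (m + k) * ((Nat.factorial (m + k) : ℝ≥0∞) / (Nat.factorial m : ℝ≥0∞)) / IFPP.factorialMoment q k) ∧
      IFPP.IsReducedPalmKernel P Φ k (Kernel.const _ (IFPP.ifppLaw q' ν)) ∧
      (∀ κ : Kernel (Fin k → G) (Measure G), IFPP.IsReducedPalmKernel P Φ k κ →
        ∀ᵐ x ∂(IFPP.factorialMomentMeasure P Φ k), κ x = IFPP.ifppLaw q' ν) ∧
      (∀ κ : Kernel (Fin k → G) (Measure G), IFPP.IsPalmKernel P Φ k κ →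
        ∀ᵐ x ∂(IFPP.momentMeasure P Φ k), Function.Injective x →
          (κ x).map (fun φ => φ - IFPP.sumDirac x) = IFPP.ifppLaw q' ν) := by
  refine ⟨?_, IFPP.reducedPMF q k hpos hfin, fun m => ?_,
    IFPP.isReducedPalmKernel_const hΦ hpos hfin, fun κ hκ => hκ.ae_eq hΦ hpos hfin,
    fun κ hκ => hκ.ae_map_sub_eq hΦ hpos hfin⟩
  · rw [IFPP.factorialMoment_eq_tsum]
    exact tsum_congr fun m => IFPP.factorialWeight_eq q k m
  · rw [IFPP.reducedPMF_apply, IFPP.factorialWeight_eq]
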